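/- Let $\mathfrak g$ be a finite-dimensional complex semisimple Lie algebra and let $\widetilde{\mathfrak g}$ be an infinite-dimensional complex Lie algebra of $\mathfrak g$-valued functions of one complex variable $u$ (defined on a common domain $U\subset\mathbb C$, with the pointwise bracket). Let $R:\widetilde{\mathfrak g}\to\widetilde{\mathfrak g}$ be a classical $R$-operator, i.e. a linear map with $$R([R X,Y]+[X,R Y])-[R X,R Y]=[X,Y]\qquad\text{for all }X,Y\in\widetilde{\mathfrak g}.$$ Write $R_\pm=R\pm1$. For a linear functional $L$ on $\widetilde{\mathfrak g}$ put $\langle R^*L,X\rangle=\langle L,RX\rangle$, $R^*_\pm=R^*\pm1$ and $\langle \mathrm{ad}^*_X L,Y\rangle=\langle L,[Y,X]\rangle$. Let $\widetilde{\mathfrak g}^*$ be a dual space of $\widetilde{\mathfrak g}$: a space of linear functionals separating the points of $\widetilde{\mathfrak g}$ and stable under $R^*$ and under the coadjoint action $\mathrm{ad}^*$ (for instance the whole algebraic dual or, when it is stable, the span of the functionals dual to a basis). Let $(I_k)$ be Casimir functions on $\widetilde{\mathfrak g}^*$, i.e. functions $\widetilde{\mathfrak g}^*\to\mathbb C$ that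 have a linear differential at every point and are invariant under the coadjoint representation, $dI_k(L)(\mathrm{ad}^*_XL)=0$ for all $X\in\widetilde{\mathfrak g}$ and $L\in\widetilde{\mathfrak g}^*$. Put $I_k^{R_\pm}(L)=I_k(R^*_\pm L)$. Suppose that those of these functions which occur in the equations below are finite polynomials, i.e. polynomials in finitely many coordinates $\langle L,X\rangle$, $X\in\widetilde{\mathfrak g}$; they then extend uniquely, as finite polynomials, to all linear functionals $L$ on $\widetilde{\mathfrak g}$ (the generic, possibly infinite, sums $L=\sum_i L_iX_i^*$). Then they have $\widetilde{\mathfrak g}$-valued gradients $\nabla I_k^{R_\pm}(L)\in\widetilde{\mathfrak g}$, determined by $\frac{d}{d\tau}\big|_{\tau=0}I_k^{R_\pm}(L+\tau M)=\langle M,\nabla I_k^{R_\pm}(L)\rangle$ for all $M$. Let $\partial/\partial t_k^\pm$ be the derivative along the Hamiltonian flow of $I_k^{R_\pm}$, i.e. along curves with $\frac{d}{dt}\langle L,X\rangle=\langle L,[X,\nabla I_k^{R_\pm}(L)]\rangle$ for all $X\in\widetilde{\mathfrak g}$, in real or complex time. Then the gradients satisfy, at every $L$ and for all $k,l$, the zero-curvature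 equations $$\frac{\partial \nabla I_k^{R_{\pm}}}{\partial t^{\pm}_l}-\frac{\partial \nabla I_l^{R_{\pm}}}{\partial t^{\pm}_k}+[\nabla I_k^{R_{\pm}},\nabla I_l^{R_{\pm}}]=0,$$ $$\frac{\partial \nabla I_k^{R_{\pm}}}{\partial t^{\mp}_l}-\frac{\partial \nabla I_l^{R_{\mp}}}{\partial t^{\pm}_k}+[\nabla I_k^{R_{\pm}},\nabla I_l^{R_{\mp}}]=0,$$ with upper signs or with lower signs throughout. -/

import Mathlib

section FunctionLieAlgebra

/-- The `𝔤`-valued functions of one complex variable `u ∈ U`. -/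
def LieFun (U : Set ℂ) (𝔤 : Type*) : Type _ := U → 𝔤

variable (U : Set ℂ) (𝔤 : Type*) [LieRing 𝔤] [LieAlgebra ℂ 𝔤]

instance : AddCommGroup (LieFun U 𝔤) := inferInstanceAs (AddCommGroup (U → 𝔤))

instance : Module ℂ (LieFun U 𝔤) := inferInstanceAs (Module ℂ (U → 𝔤))

/-- The bracket of functions is pointwise. -/
instance : LieRing (LieFun U 𝔤) where
  bracket f g := fun u => ⁅f u, g u⁆
  add_lie f g h := funext fun u => add_lie (f u) (g u) (h u)
  lie_add f g h := funext fun u => lie_add (f u) (g u) (h u)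
  lie_self f := funext fun u => lie_self (f u)
  leibniz_lie f g h := funext fun u => leibniz_lie (f u) (g u) (h u)

instance : LieAlgebra ℂ (LieFun U 𝔤) where
  lie_smul c f g := funext fun u => lie_smul c (f u) (g u)

end FunctionLieAlgebra

section ROperators

variable {𝔞 : Type*} [LieRing 𝔞] [LieAlgebra ℂ 𝔞]

/-- A classical `R`-operator on a complex Lie algebra: a linear solution of the modified
Yang-Baxter equation. -/
def IsClassicalROperator (R : 𝔞 →ₗ[ℂ] 𝔞) : Prop :=
  ∀ X Y : 𝔞, R (⁅R X, Y⁆ + ⁅X, R Y⁆) - ⁅R X, R Y⁆ = ⁅X, Y⁆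

/-- The operators `R₊ = R + 1` and `R₋ = R - 1`; the sign is `ε = 1` or `ε = -1`. -/
def rShift (R : 𝔞 →ₗ[ℂ] 𝔞) (ε : ℤˣ) : 𝔞 →ₗ[ℂ] 𝔞 :=
  R + (((ε : ℤ) : ℂ)) • LinearMap.id

/-- The coadjoint action `ad*_X L = (Y ↦ ⟨L, [Y, X]⟩)` on linear functionals. -/
def coadjoint (X : 𝔞) (L : Module.Dual ℂ 𝔞) : Module.Dual ℂ 𝔞 :=
  -(L ∘ₗ (LieAlgebra.ad ℂ 𝔞 X : 𝔞 →ₗ[ℂ] 𝔞))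

theorem coadjoint_apply (X Y : 𝔞) (L : Module.Dual ℂ 𝔞) : coadjoint X L Y = L ⁅Y, X⁆ := by
  have h : ⁅Y, X⁆ = -⁅X, Y⁆ := (lie_skew Y X).symm
  rw [h, map_neg]
  rfl

/-- A space of linear functionals in duality with `𝔞` on which the coadjoint representation and
the dual operator `R*` act. Examples are the whole algebraic dual, and, for loop algebras with the
usual (Kostant-Adler-Symes or triangular) `R`-operators, the span of the functionals dual to a
homogeneous basis. On the latter the Casimir functions, which are formal infinite polynomials in
the coordinates, are honest functions. -/
structure DualSpace (R : 𝔞 →ₗ[ℂ] 𝔞) where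
  /-- the functionals -/
  space : Submodule ℂ (Module.Dual ℂ 𝔞)
  /-- the pairing with `𝔞` is nondegenerate -/
  separating : ∀ X : 𝔞, (∀ L ∈ space, L X = 0) → X = 0
  /-- the coadjoint representation acts -/
  coadjoint_mem : ∀ (X : 𝔞), ∀ L ∈ space, coadjoint X L ∈ space
  /-- the dual operator `R*` acts -/
  dual_mem : ∀ L ∈ space, L ∘ₗ R ∈ space

theorem DualSpace.rShift_mem {R : 𝔞 →ₗ[ℂ] 𝔞} (D : DualSpace R) (ε : ℤˣ)
    (L : Module.Dual ℂ 𝔞) (hL : L ∈ D.space) : L ∘ₗ rShift R ε ∈ D.space := by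
  have h : L ∘ₗ rShift R ε = L ∘ₗ R + (((ε : ℤ) : ℂ)) • L := by
    ext X
    simp [rShift]
  rw [h]
  exact D.space.add_mem (D.dual_mem L hL) (D.space.smul_mem _ hL)

/-- A Casimir function: a function on the dual space which has at every point a linear (Gateaux)
differential, and whose differential annihilates all coadjoint directions, that is, an invariant
of the coadjoint representation. -/
def IsCasimir {R : 𝔞 →ₗ[ℂ] 𝔞} (D : DualSpace R) (I : D.space → ℂ) : Prop :=
  ∃ dI : D.space → Module.Dual ℂ D.space,
    (∀ L M : D.space, HasLineDerivAt ℂ I (dI L M) L M) ∧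
    ∀ (X : 𝔞) (L : D.space),
      dI L ⟨coadjoint X (L : Module.Dual ℂ 𝔞), D.coadjoint_mem X L L.2⟩ = 0

/-- The function `I^{R_ε}(L) = I((R* + ε) L)`. -/
def rFunction {R : 𝔞 →ₗ[ℂ] 𝔞} (D : DualSpace R) (I : D.space → ℂ) (ε : ℤˣ) : D.space → ℂ :=
  fun L => I ⟨(L : Module.Dual ℂ 𝔞) ∘ₗ rShift R ε, D.rShift_mem ε L L.2⟩

/-- Finite polynomials in the coordinate functions `L ↦ ⟨L, X⟩`, `X ∈ 𝔞`, on the algebraic dual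
(whose elements are the generic, possibly infinite, sums `∑ L_i X_i*`). -/
def IsFinitePolynomial (P : Module.Dual ℂ 𝔞 → ℂ) : Prop :=
  P ∈ Algebra.adjoin ℂ (Set.range fun (X : 𝔞) (L : Module.Dual ℂ 𝔞) => L X)

/-- The finite polynomial `P` is the function `I^{R_ε}`. A finite polynomial is determined by its
restriction to a separating space of functionals, so there is at most one such `P`. -/
def IsPolynomialOf {R : 𝔞 →ₗ[ℂ] 𝔞} (D : DualSpace R) (I : D.space → ℂ) (ε : ℤˣ)
    (P : Module.Dual ℂ 𝔞 → ℂ) : Prop :=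
  IsFinitePolynomial P ∧ ∀ L : D.space, P (L : Module.Dual ℂ 𝔞) = rFunction D I ε L

/-- `V` is the algebra-valued gradient `∇P = ∑ (∂P/∂L_i) X_i` of `P`: the derivative of `P` at `L`
in the direction `M` is `⟨M, V L⟩`. -/
def IsAlgGradient (P : Module.Dual ℂ 𝔞 → ℂ) (V : Module.Dual ℂ 𝔞 → 𝔞) : Prop :=
  ∀ L M : Module.Dual ℂ 𝔞, HasLineDerivAt ℂ P (M (V L)) L M

/-- `γ` satisfies at time `s` the Hamiltonian equation `dL/dt = ad*_{V(L)} L`, in coordinates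
`d⟨L, X⟩/dt = ⟨L, [X, V(L)]⟩`, where `V` is the gradient of the Hamiltonian. Time runs over `𝕜`. -/
def IsHamiltonianAt (𝕜 : Type*) [RCLike 𝕜] [NormedAlgebra 𝕜 ℂ] (V : Module.Dual ℂ 𝔞 → 𝔞)
    (γ : 𝕜 → Module.Dual ℂ 𝔞) (s : 𝕜) : Prop :=
  ∀ X : 𝔞, HasDerivAt (fun t => γ t X) (coadjoint (V (γ s)) (γ s) X) s

/-- `W` is the time derivative of the `𝔞`-valued function `A` along the Hamiltonian flow with
gradient `V`: along every curve that satisfies the Hamiltonian equation at time `s`, the function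
`A` has the derivative `W` at time `s`, tested by all linear functionals on `𝔞`. The straight line
through `L` with velocity `ad*_{V(L)} L` is such a curve, so `W` is determined everywhere. -/
def IsTimeDeriv (𝕜 : Type*) [RCLike 𝕜] [NormedAlgebra 𝕜 ℂ] (V A W : Module.Dual ℂ 𝔞 → 𝔞) : Prop :=
  ∀ (γ : 𝕜 → Module.Dual ℂ 𝔞) (s : 𝕜), IsHamiltonianAt 𝕜 V γ s →
    ∀ φ : Module.Dual ℂ 𝔞, HasDerivAt (fun t => φ (A (γ t))) (φ (W (γ s))) s

/-- The gradients of `P` and `Q` exist, have time derivatives along each other's flows, and satisfy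
the zero-curvature equation `∂∇P/∂t_Q - ∂∇Q/∂t_P + [∇P, ∇Q] = 0` at every point. -/
def ZeroCurvature (𝕜 : Type*) [RCLike 𝕜] [NormedAlgebra 𝕜 ℂ] (P Q : Module.Dual ℂ 𝔞 → ℂ) : Prop :=
  ∃ VP VQ WP WQ : Module.Dual ℂ 𝔞 → 𝔞,
    IsAlgGradient P VP ∧ IsAlgGradient Q VQ ∧
    IsTimeDeriv 𝕜 VQ VP WP ∧ IsTimeDeriv 𝕜 VP VQ WQ ∧
    ∀ L : Module.Dual ℂ 𝔞, WP L - WQ L + ⁅VP L, VQ L⁆ = 0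

end ROperators

/-! ### Gradients and Hessians of finite polynomials -/

section PolynomialJets

variable {𝔞 : Type*} [LieRing 𝔞] [LieAlgebra ℂ 𝔞]

/-! The zero-curvature equation is the differential of an involution relation. If `⟨L, [∇P, ∇Q]⟩`
vanishes for every `L`, differentiate it in a direction `M`; symmetry of the two Hessians turns the
result into `M` applied to the zero-curvature expression, and functionals separate points
(`HasPolynomialJet.zeroCurvature`). Involution follows on the dual space from the identity
`lie_rShift` and the invariance of both Casimirs (`poisson_eq_zero`). It passes to all functionals
because only finitely many coordinates matter at each point (`exists_eqOn`). -/

/-- `V` and `H` are the gradient and the Hessian of the finite polynomial `P`, computed by the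
rules of the differential calculus from an expression of `P` through coordinate functions. -/
inductive HasPolynomialJet : (Module.Dual ℂ 𝔞 → ℂ) → (Module.Dual ℂ 𝔞 → 𝔞) →
    (Module.Dual ℂ 𝔞 → Module.Dual ℂ 𝔞 → 𝔞) → Prop
  | const (c : ℂ) : HasPolynomialJet (fun _ => c) (fun _ => 0) (fun _ _ => 0)
  | coord (X : 𝔞) : HasPolynomialJet (fun L => L X) (fun _ => X) (fun _ _ => 0)
  | add {P Q V W H K} : HasPolynomialJet P V H → HasPolynomialJet Q W K →
      HasPolynomialJet (fun L => P L + Q L) (fun L => V L + W L) (fun L M => H L M + K L M)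
  | mul {P Q V W H K} : HasPolynomialJet P V H → HasPolynomialJet Q W K →
      HasPolynomialJet (fun L => P L * Q L) (fun L => P L • W L + Q L • V L)
        (fun L M => (M (V L) • W L + P L • K L M) + (M (W L) • V L + Q L • H L M))

theorem IsFinitePolynomial.exists_jet {P : Module.Dual ℂ 𝔞 → ℂ} (hP : IsFinitePolynomial P) :
    ∃ V H, HasPolynomialJet P V H := by
  induction hP using Algebra.adjoin_induction with
  | mem x hx => obtain ⟨X, rfl⟩ := hx; exact ⟨_, _, .coord X⟩
  | algebraMap r => exact ⟨_, _, .const r⟩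
  | add x y _ _ hx hy =>
    obtain ⟨V, H, hx⟩ := hx
    obtain ⟨W, K, hy⟩ := hy
    exact ⟨_, _, hx.add hy⟩
  | mul x y _ _ hx hy =>
    obtain ⟨V, H, hx⟩ := hx
    obtain ⟨W, K, hy⟩ := hy
    exact ⟨_, _, hx.mul hy⟩

/-- `γ'` is the derivative of the curve `γ` at `s` in every coordinate. -/
def HasCoordDerivAt {𝕜 : Type*} [RCLike 𝕜] [NormedAlgebra 𝕜 ℂ] (γ : 𝕜 → Module.Dual ℂ 𝔞)
    (γ' : Module.Dual ℂ 𝔞) (s : 𝕜) : Prop :=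
  ∀ X : 𝔞, HasDerivAt (fun t => γ t X) (γ' X) s

theorem hasCoordDerivAt_line (L M : Module.Dual ℂ 𝔞) :
    HasCoordDerivAt (fun t : ℂ => L + t • M) M 0 := fun X => by
  simpa using ((hasDerivAt_id (0 : ℂ)).mul_const (M X)).const_add (L X)

namespace HasPolynomialJet

variable {P Q : Module.Dual ℂ 𝔞 → ℂ} {V W : Module.Dual ℂ 𝔞 → 𝔞}
  {H K : Module.Dual ℂ 𝔞 → Module.Dual ℂ 𝔞 → 𝔞}
  {𝕜 : Type*} [RCLike 𝕜] [NormedAlgebra 𝕜 ℂ]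

theorem hessian_symm (h : HasPolynomialJet P V H) (L M N : Module.Dual ℂ 𝔞) :
    N (H L M) = M (H L N) := by
  induction h with
  | const c => simp
  | coord X => simp
  | add _ _ h k => simp [h, k]
  | mul _ _ h k => simp only [map_add, map_smul, smul_eq_mul, h, k]; ring

/-- A finite polynomial and its gradient depend on finitely many coordinates only. -/
theorem exists_finite_eqOn (h : HasPolynomialJet P V H) :
    ∃ s : Set 𝔞, s.Finite ∧
      ∀ L L' : Module.Dual ℂ 𝔞, Set.EqOn L L' s → P L = P L' ∧ V L = V L' := by
  induction h with
  | const c => exact ⟨∅, Set.finite_empty, fun _ _ _ => ⟨rfl, rfl⟩⟩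
  | coord X => exact ⟨{X}, Set.finite_singleton X, fun _ _ h => ⟨h rfl, rfl⟩⟩
  | add _ _ h k =>
    obtain ⟨s, hs, h⟩ := h
    obtain ⟨t, ht, k⟩ := k
    refine ⟨s ∪ t, hs.union ht, fun L L' e => ?_⟩
    have h := h L L' (e.mono Set.subset_union_left)
    have k := k L L' (e.mono Set.subset_union_right)
    simp only [h.1, h.2, k.1, k.2, and_self]
  | mul _ _ h k =>
    obtain ⟨s, hs, h⟩ := h
    obtain ⟨t, ht, k⟩ := k
    refine ⟨s ∪ t, hs.union ht, fun L L' e => ?_⟩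
    have h := h L L' (e.mono Set.subset_union_left)
    have k := k L L' (e.mono Set.subset_union_right)
    simp only [h.1, h.2, k.1, k.2, and_self]

/-- Induction over the polynomial expression needs only coordinatewise differentiability of the
curve, so no topology on the dual enters. -/
theorem hasDerivAt_comp (h : HasPolynomialJet P V H) {γ : 𝕜 → Module.Dual ℂ 𝔞}
    {γ' : Module.Dual ℂ 𝔞} {s : 𝕜} (hγ : HasCoordDerivAt γ γ' s) :
    HasDerivAt (fun t => P (γ t)) (γ' (V (γ s))) s := by
  induction h with
  | const c => simpa using hasDerivAt_const s c
  | coord X => exact hγ X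
  | add _ _ h k => simpa only [map_add] using h.fun_add k
  | mul _ _ h k =>
    refine (h.fun_mul k).congr_deriv ?_
    simp only [map_add, map_smul, smul_eq_mul]
    ring

/-- The derivative of the pairing of a moving functional with the gradient along a curve. -/
theorem hasDerivAt_pairing (h : HasPolynomialJet P V H) {γ ψ : 𝕜 → Module.Dual ℂ 𝔞}
    {γ' ψ' : Module.Dual ℂ 𝔞} {s : 𝕜} (hγ : HasCoordDerivAt γ γ' s)
    (hψ : HasCoordDerivAt ψ ψ' s) :
    HasDerivAt (fun t => ψ t (V (γ t))) (ψ' (V (γ s)) + ψ s (H (γ s) γ')) s := by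
  induction h with
  | const c => simpa using hasDerivAt_const s (0 : ℂ)
  | coord X => simpa using hψ X
  | add _ _ h k =>
    simp only [map_add]
    exact (h.fun_add k).congr_deriv (by ring)
  | mul hP hQ h k =>
    simp only [map_add, map_smul, smul_eq_mul]
    refine (((hP.hasDerivAt_comp hγ).fun_mul k).fun_add
      ((hQ.hasDerivAt_comp hγ).fun_mul h)).congr_deriv ?_
    ring

theorem isAlgGradient (h : HasPolynomialJet P V H) : IsAlgGradient P V := fun L M => by
  simpa [HasLineDerivAt] using h.hasDerivAt_comp (hasCoordDerivAt_line L M)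

theorem isTimeDeriv (h : HasPolynomialJet P V H) (W : Module.Dual ℂ 𝔞 → 𝔞) :
    IsTimeDeriv 𝕜 W V (fun L => H L (coadjoint (W L) L)) := fun γ s hγ φ => by
  simpa using h.hasDerivAt_pairing (γ' := coadjoint (W (γ s)) (γ s)) hγ
    (ψ := fun _ => φ) (ψ' := 0) (fun X => hasDerivAt_const s (φ X))

/-- The derivative of the Poisson bracket `L ↦ ⟨L, [∇P, ∇Q]⟩` at `L` in the direction `M`. -/
theorem hasDerivAt_poisson (h : HasPolynomialJet P V H) (k : HasPolynomialJet Q W K)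
    (L M : Module.Dual ℂ 𝔞) :
    HasDerivAt (fun t : ℂ => (L + t • M) ⁅V (L + t • M), W (L + t • M)⁆)
      (M ⁅V L, W L⁆ + L ⁅V L, K L M⁆ + L ⁅H L M, W L⁆) 0 := by
  have hγ := hasCoordDerivAt_line L M
  -- The bracket is the moving functional `ad*_W L` paired with `V`. Its coordinate at `X` is in
  -- turn `L ∘ ad X` paired with `W`, so the pairing rule applies twice.
  have hψ : HasCoordDerivAt (fun t : ℂ => coadjoint (W (L + t • M)) (L + t • M))
      (coadjoint (W L) M + coadjoint (K L M) L) 0 := fun X => by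
    have := k.hasDerivAt_pairing hγ
      (ψ := fun t : ℂ => (L + t • M) ∘ₗ (LieAlgebra.ad ℂ 𝔞 X : 𝔞 →ₗ[ℂ] 𝔞))
      (ψ' := M ∘ₗ (LieAlgebra.ad ℂ 𝔞 X : 𝔞 →ₗ[ℂ] 𝔞)) (fun Y => hγ ⁅X, Y⁆)
    simpa [coadjoint_apply] using this
  simpa [coadjoint_apply] using h.hasDerivAt_pairing hγ hψ

/-- Polynomials in involution satisfy the zero-curvature equation. -/
theorem zeroCurvature (h : HasPolynomialJet P V H) (k : HasPolynomialJet Q W K)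
    (hPQ : ∀ L : Module.Dual ℂ 𝔞, L ⁅V L, W L⁆ = 0) : ZeroCurvature 𝕜 P Q := by
  refine ⟨V, W, _, _, h.isAlgGradient, k.isAlgGradient, h.isTimeDeriv W, k.isTimeDeriv V,
    fun L => (Module.forall_dual_apply_eq_zero_iff ℂ _).1 fun M => ?_⟩
  have h0 := h.hasDerivAt_poisson k L M
  simp only [hPQ] at h0
  have h1 := h0.unique (hasDerivAt_const _ _)
  -- Hessian symmetry takes `M` into the Hessians and leaves the coadjoint vectors outside, which
  -- matches the terms of `h1`.
  rw [map_add, map_sub, h.hessian_symm, k.hessian_symm, coadjoint_apply, coadjoint_apply,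
    ← lie_skew (K L M), map_neg]
  linear_combination h1

end HasPolynomialJet

end PolynomialJets

/-! ### Involution of shifted Casimir functions -/

section Involution

variable {𝔞 : Type*} [LieRing 𝔞] [LieAlgebra ℂ 𝔞] {R : 𝔞 →ₗ[ℂ] 𝔞}

/-- The functionals of a dual space take all systems of values on finitely many elements that
linear functionals take. -/
theorem DualSpace.exists_eqOn (D : DualSpace R) {s : Set 𝔞} (hs : s.Finite)
    (L : Module.Dual ℂ 𝔞) : ∃ M ∈ D.space, Set.EqOn L M s := by
  let F := Submodule.span ℂ s
  have : FiniteDimensional ℂ F := FiniteDimensional.span_of_finite ℂ hs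
  let T := D.space.map F.dualRestrict
  have hT : T.dualCoannihilator = ⊥ := by
    refine (Submodule.eq_bot_iff _).2 fun x hx => Subtype.ext (D.separating x fun M hM => ?_)
    exact (Submodule.mem_dualCoannihilator x).1 hx _ (Submodule.mem_map_of_mem hM)
  -- In the finite-dimensional span of `s`, a space of functionals with no common zero vector is the
  -- full dual.
  have hT' : T = ⊤ := by
    rw [← Subspace.dualCoannihilator_dualAnnihilator_eq (W := T), hT,
      Submodule.dualAnnihilator_bot]
  obtain ⟨M, hM, h⟩ : F.dualRestrict L ∈ T := hT' ▸ Submodule.mem_top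
  exact ⟨M, hM, fun x hx =>
    (LinearMap.congr_fun h (⟨x, Submodule.subset_span hx⟩ : F)).symm⟩

/-- The shift `-δ` cancels the terms `δ R[Y, Z]`, and `δ² = 1` supplies the `-[Y, Z]` of the
Yang-Baxter equation. -/
theorem IsClassicalROperator.lie_rShift (hR : IsClassicalROperator R) (ε δ : ℤˣ) (Y Z : 𝔞) :
    ⁅rShift R ε Y, rShift R δ Z⁆ =
      rShift R ε ⁅Y, rShift R δ Z⁆ + rShift R δ ⁅rShift R (-δ) Y, Z⁆ := by
  have h : ⁅R Y, R Z⁆ = R ⁅R Y, Z⁆ + R ⁅Y, R Z⁆ - ⁅Y, Z⁆ := by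
    rw [← hR Y Z, map_add]; abel
  rcases Int.units_eq_one_or ε with rfl | rfl <;> rcases Int.units_eq_one_or δ with rfl | rfl <;>
  · simp [rShift, h, -lie_skew]
    abel

/-- The gradient of `I^{R_ε}` at `L` is `R_ε` applied to the differential of `I` at `R_ε* L`. -/
theorem IsPolynomialOf.apply_gradient {D : DualSpace R} {I : D.space → ℂ} {ε : ℤˣ}
    {P : Module.Dual ℂ 𝔞 → ℂ} (hP : IsPolynomialOf D I ε P) {V : Module.Dual ℂ 𝔞 → 𝔞}
    (hV : IsAlgGradient P V) {dI : D.space → Module.Dual ℂ D.space}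
    (hI : ∀ L M : D.space, HasLineDerivAt ℂ I (dI L M) L M) (L M : D.space) :
    (M : Module.Dual ℂ 𝔞) (V L) =
      dI ⟨L.1 ∘ₗ rShift R ε, D.rShift_mem ε L L.2⟩
        ⟨M.1 ∘ₗ rShift R ε, D.rShift_mem ε M M.2⟩ := by
  refine HasLineDerivAt.unique (hV L M) ?_
  have h := hI ⟨L.1 ∘ₗ rShift R ε, D.rShift_mem ε L L.2⟩
    ⟨M.1 ∘ₗ rShift R ε, D.rShift_mem ε M M.2⟩
  have e : (fun t : ℂ => P (L.1 + t • M.1)) = fun t : ℂ =>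
      I (⟨L.1 ∘ₗ rShift R ε, D.rShift_mem ε L L.2⟩ +
        t • ⟨M.1 ∘ₗ rShift R ε, D.rShift_mem ε M M.2⟩) := by
    funext t
    exact hP.2 (L + t • M)
  unfold HasLineDerivAt at h ⊢
  rwa [e]

/-- The functions `I^{R_ε}` and `J^{R_δ}` of Casimir functions `I`, `J` are in involution on the
dual space. -/
theorem IsClassicalROperator.poisson_eq_zero (hR : IsClassicalROperator R) {D : DualSpace R}
    {I J : D.space → ℂ} (hI : IsCasimir D I) (hJ : IsCasimir D J) {ε δ : ℤˣ}
    {P Q : Module.Dual ℂ 𝔞 → ℂ} (hP : IsPolynomialOf D I ε P) (hQ : IsPolynomialOf D J δ Q)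
    {V W : Module.Dual ℂ 𝔞 → 𝔞} (hV : IsAlgGradient P V) (hW : IsAlgGradient Q W)
    (L : D.space) : L.1 ⁅V L, W L⁆ = 0 := by
  obtain ⟨dI, hdI, hI0⟩ := hI
  obtain ⟨dJ, hdJ, hJ0⟩ := hJ
  let Lε : D.space := ⟨L.1 ∘ₗ rShift R ε, D.rShift_mem ε L L.2⟩
  let Lδ : D.space := ⟨L.1 ∘ₗ rShift R δ, D.rShift_mem δ L L.2⟩
  let act (X : 𝔞) (M : D.space) : D.space := ⟨coadjoint X M.1, D.coadjoint_mem X M M.2⟩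
  -- Invariance of `J`: by `lie_rShift`, the two functionals pulled back by `R_δ` differ by a
  -- coadjoint direction at `R_δ* L`, which `dJ` kills there.
  have key (Y : 𝔞) : L.1 ⁅rShift R ε Y, W L⁆ = L.1 (rShift R ε ⁅Y, W L⁆) := by
    have h1 := hQ.apply_gradient hW hdJ L (act (rShift R ε Y) L)
    have h2 := hQ.apply_gradient hW hdJ L (act Y Lε)
    have e : (⟨(act (rShift R ε Y) L).1 ∘ₗ rShift R δ, D.rShift_mem δ _ (act _ L).2⟩ : D.space) =
        ⟨(act Y Lε).1 ∘ₗ rShift R δ, D.rShift_mem δ _ (act _ Lε).2⟩ +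
          act (rShift R (-δ) Y) Lδ := by
      ext Z
      simp only [act, Lε, Lδ, Submodule.coe_add, LinearMap.add_apply, LinearMap.comp_apply,
        coadjoint_apply]
      rw [← lie_skew, ← lie_skew _ Y, ← lie_skew Z, hR.lie_rShift]
      simp only [map_neg, map_add]
      ring
    rw [e, map_add, hJ0, add_zero, ← h2] at h1
    simp only [act, Lε, coadjoint_apply, LinearMap.comp_apply] at h1
    rw [← lie_skew, ← lie_skew Y, map_neg, map_neg, map_neg, h1]
  have h1 := hP.apply_gradient hV hdI L (act (W L) L)
  -- By `key`, pulling `ad*_W L` back by `R_ε` gives a coadjoint direction at `R_ε* L`, so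
  -- invariance of `I` finishes.
  have e : (⟨(act (W L) L).1 ∘ₗ rShift R ε, D.rShift_mem ε _ (act _ L).2⟩ : D.space) =
      act (W L) Lε := by
    ext Y
    simpa only [act, Lε, LinearMap.comp_apply, coadjoint_apply] using key Y
  rw [e, hI0] at h1
  simpa only [act, coadjoint_apply] using h1

theorem IsClassicalROperator.zeroCurvature (hR : IsClassicalROperator R) {D : DualSpace R}
    {I J : D.space → ℂ} (hI : IsCasimir D I) (hJ : IsCasimir D J) {ε δ : ℤˣ}
    {P Q : Module.Dual ℂ 𝔞 → ℂ} (hP : IsPolynomialOf D I ε P) (hQ : IsPolynomialOf D J δ Q)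
    (𝕜 : Type*) [RCLike 𝕜] [NormedAlgebra 𝕜 ℂ] : ZeroCurvature 𝕜 P Q := by
  obtain ⟨V, H, h⟩ := hP.1.exists_jet
  obtain ⟨W, K, k⟩ := hQ.1.exists_jet
  refine h.zeroCurvature k fun L => ?_
  obtain ⟨s, hs, hsV⟩ := h.exists_finite_eqOn
  obtain ⟨t, ht, htW⟩ := k.exists_finite_eqOn
  -- The Casimirs live only on `D.space`, so `L` is replaced by some `M` there with the same
  -- gradients; inserting the bracket keeps its value too.
  obtain ⟨M, hM, e⟩ := D.exists_eqOn ((hs.union ht).insert ⁅V L, W L⁆) L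
  rw [e (Set.mem_insert _ _),
    (hsV L M (e.mono (Set.subset_union_left.trans (Set.subset_insert _ _)))).2,
    (htW L M (e.mono (Set.subset_union_right.trans (Set.subset_insert _ _)))).2]
  exact hR.poisson_eq_zero hI hJ hP hQ h.isAlgGradient k.isAlgGradient ⟨M, hM⟩

end Involution

theorem theorem2 {𝔤 : Type*} [LieRing 𝔤] [LieAlgebra ℂ 𝔤] [FiniteDimensional ℂ 𝔤]
    [LieAlgebra.IsSemisimple ℂ 𝔤]
    (U : Set ℂ) (𝔤t : LieSubalgebra ℂ (LieFun U 𝔤)) (hinf : ¬ FiniteDimensional ℂ 𝔤t)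
    (R : 𝔤t →ₗ[ℂ] 𝔤t) (hR : IsClassicalROperator R) (D : DualSpace R)
    {ι : Type*} (I : ι → D.space → ℂ) (hI : ∀ k, IsCasimir D (I k))
    (𝕜 : Type*) [RCLike 𝕜] [NormedAlgebra 𝕜 ℂ] :
    (∀ (ε : ℤˣ) (k l : ι) (P Q : Module.Dual ℂ 𝔤t → ℂ),
      IsPolynomialOf D (I k) ε P → IsPolynomialOf D (I l) ε Q → ZeroCurvature 𝕜 P Q) ∧
    (∀ (ε : ℤˣ) (k l : ι) (P Q : Module.Dual ℂ 𝔤t → ℂ),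
      IsPolynomialOf D (I k) ε P → IsPolynomialOf D (I l) (-ε) Q → ZeroCurvature 𝕜 P Q) := by
  exact ⟨fun _ k l _ _ hP hQ => hR.zeroCurvature (hI k) (hI l) hP hQ 𝕜,
    fun _ k l _ _ hP hQ => hR.zeroCurvature (hI k) (hI l) hP hQ 𝕜⟩
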